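/- Let $\iota_X\colon A\to X$ be any continuous map of topological spaces; $\simeq$ denotes (free) homotopy of maps. The Ganea construction of $\iota_X$ is the sequence of spaces and maps defined as follows. Put $G_0=A$, $g_0=\iota_X$, $\alpha_0=\mathrm{id}_A$. For $i\ge 0$ let $F_i$ be the homotopy pullback of $g_i\colon G_i\to X$ and $\iota_X$, with projections $\beta_i\colon F_i\to G_i$ and $\eta_i\colon F_i\to A$; let $G_{i+1}$ be the homotopy pushout of $\beta_i$ and $\eta_i$, with canonical maps $\gamma_i\colon G_i\to G_{i+1}$ and $\alpha_{i+1}\colon A\to G_{i+1}$; and let $g_{i+1}=(g_i,\iota_X)\colon G_{i+1}\to X$ be the whisker map induced by this homotopy pushout. For $k\le n$ put $\gamma_{k,n}=\gamma_{n-1}\circ\cdots\circ\gamma_k\colon G_k\to G_n$, with $\gamma_{k,k}=\mathrm{id}_{G_k}$. The relative category $\operatorname{relcat}\iota_X$ is the least integer $n\ge 0$ for which there is a map $\sigma\colon X\to G_n$ with $g_n\circ\sigma\simeq\mathrm{id}_X$ and $\sigma\circ\iota_X\simeq\alpha_n$. For an integer $k\ge 0$, the relative category of order $k$, $\operatorname{relcat}_k\iota_X$,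 is the least integer $n\ge k$ for which there is a map $\sigma\colon X\to G_n$ with $g_n\circ\sigma\simeq\mathrm{id}_X$ and $\sigma\circ g_k\simeq\gamma_{k,n}$. Each is $\infty$ if no such $n$ exists. Then, for every map $\iota_X\colon A\to X$ and every integer $k\ge 0$, $$\operatorname{relcat}\iota_X\;\le\;\operatorname{relcat}_k\iota_X\;\le\;\operatorname{relcat}\iota_X+k .$$ -/

import Mathlib

open scoped unitInterval

universe u

namespace GaneaConstruction

section Squares

variable {A B F X : Type u} [TopologicalSpace A] [TopologicalSpace B] [TopologicalSpace F]
  [TopologicalSpace X]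

/-- The (standard) homotopy pullback of `f : B → X` and `g : A → X`: triples `(b, ω, a)` where `ω`
is a path in `X` from `f b` to `g a`, topologised as a subspace of `B × X^I × A`
(with the compact-open topology on `X^I`). -/
def HomotopyPullback (f : C(B, X)) (g : C(A, X)) : Type u :=
  {p : B × C(I, X) × A // p.2.1 0 = f p.1 ∧ p.2.1 1 = g p.2.2}

instance (f : C(B, X)) (g : C(A, X)) : TopologicalSpace (HomotopyPullback f g) :=
  inferInstanceAs (TopologicalSpace {p : B × C(I, X) × A // p.2.1 0 = f p.1 ∧ p.2.1 1 = g p.2.2})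

namespace HomotopyPullback

/-- The projection of the homotopy pullback of `f` and `g` onto the source of `f`. -/
def fst (f : C(B, X)) (g : C(A, X)) : C(HomotopyPullback f g, B) where
  toFun p := p.1.1
  continuous_toFun := continuous_fst.comp continuous_subtype_val

/-- The projection of the homotopy pullback of `f` and `g` onto the source of `g`. -/
def snd (f : C(B, X)) (g : C(A, X)) : C(HomotopyPullback f g, A) where
  toFun p := p.1.2.2
  continuous_toFun := (continuous_snd.comp continuous_snd).comp continuous_subtype_val

/-- The homotopy `(t, (b, ω, a)) ↦ ω t` that makes the homotopy pullback square commute. -/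
def homotopy (f : C(B, X)) (g : C(A, X)) :
    ContinuousMap.Homotopy (f.comp (fst f g)) (g.comp (snd f g)) where
  toFun q := q.2.1.2.1 q.1
  continuous_toFun := by
    have h : Continuous fun q : I × HomotopyPullback f g => q.2.1.2.1 :=
      (continuous_fst.comp continuous_snd).comp (continuous_subtype_val.comp continuous_snd)
    exact h.eval continuous_fst
  map_zero_left p := p.2.1
  map_one_left p := p.2.2

end HomotopyPullback

/-- The gluing relation of the double mapping cylinder of `B ← F → A`. -/
inductive CylinderRel (β : C(F, B)) (η : C(F, A)) : B ⊕ (I × F) ⊕ A → B ⊕ (I × F) ⊕ A → Prop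
  | left (z : F) : CylinderRel β η (.inr (.inl (0, z))) (.inl (β z))
  | right (z : F) : CylinderRel β η (.inr (.inl (1, z))) (.inr (.inr (η z)))

/-- The (standard) homotopy pushout of `β : F → B` and `η : F → A`: the double mapping cylinder,
that is the quotient of `B ⊔ (I × F) ⊔ A` by `(0, z) ∼ β z` and `(1, z) ∼ η z`, with the quotient
topology. -/
def HomotopyPushout (β : C(F, B)) (η : C(F, A)) : Type u :=
  Quot (CylinderRel β η)

instance (β : C(F, B)) (η : C(F, A)) : TopologicalSpace (HomotopyPushout β η) :=
  inferInstanceAs (TopologicalSpace (Quot (CylinderRel β η)))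

namespace HomotopyPushout

/-- The canonical map `B → HomotopyPushout β η`. -/
def inl (β : C(F, B)) (η : C(F, A)) : C(B, HomotopyPushout β η) where
  toFun b := Quot.mk _ (.inl b)
  continuous_toFun := continuous_quot_mk.comp continuous_inl

/-- The canonical map `A → HomotopyPushout β η`. -/
def inr (β : C(F, B)) (η : C(F, A)) : C(A, HomotopyPushout β η) where
  toFun a := Quot.mk _ (.inr (.inr a))
  continuous_toFun := continuous_quot_mk.comp (continuous_inr.comp continuous_inr)

/-- The whisker map out of a homotopy pushout: `u` on `B`, `v` on `A`, and the given homotopy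
`u ∘ β ≃ v ∘ η` on the cylinder `I × F`. -/
def whisker (β : C(F, B)) (η : C(F, A)) (u : C(B, X)) (v : C(A, X))
    (H : ContinuousMap.Homotopy (u.comp β) (v.comp η)) : C(HomotopyPushout β η, X) where
  toFun := Quot.lift (Sum.elim u (Sum.elim H v)) (by
    rintro _ _ (z | z)
    · simp
    · simp)
  continuous_toFun := continuous_quot_lift _
    (u.continuous.sumElim (H.continuous.sumElim v.continuous))

end HomotopyPushout

end Squares

section Construction

variable {A X : Type u} [TopologicalSpace A] [TopologicalSpace X]

/-- The data `A --α--> G --g--> X` carried along in the Ganea construction of a map `A → X`. -/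
structure Stage (A X : Type u) [TopologicalSpace A] [TopologicalSpace X] where
  /-- the space `G` -/
  carrier : Type u
  [top : TopologicalSpace carrier]
  /-- the map `g : G → X` -/
  g : C(carrier, X)
  /-- the map `α : A → G` -/
  α : C(A, carrier)

attribute [instance] Stage.top

/-- One step of the Ganea construction of `ι : A → X`. Let `F` be the homotopy pullback of
`g : G → X` and `ι`, with projections `β : F → G` and `η : F → A`. The next space is the homotopy
pushout of `β` and `η`, the next `g` is the whisker map `(g, ι)`, and the next `α` is the canonical
map of `A` into the homotopy pushout. -/
def nextStage (ι : C(A, X)) (S : Stage A X) : Stage A X where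
  carrier := HomotopyPushout (HomotopyPullback.fst S.g ι) (HomotopyPullback.snd S.g ι)
  g := HomotopyPushout.whisker _ _ S.g ι (HomotopyPullback.homotopy S.g ι)
  α := HomotopyPushout.inr _ _

/-- The Ganea construction of `ι : A → X`, starting with `G₀ = A`, `g₀ = ι`, `α₀ = id`. -/
def stage (ι : C(A, X)) : ℕ → Stage A X
  | 0 => { carrier := A, g := ι, α := ContinuousMap.id A }
  | i + 1 => nextStage ι (stage ι i)

/-- The `i`-th Ganea space `Gᵢ(ι)`. -/
abbrev G (ι : C(A, X)) (i : ℕ) : Type u := (stage ι i).carrier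

/-- The `i`-th Ganea map `gᵢ : Gᵢ(ι) → X`. -/
def g (ι : C(A, X)) (i : ℕ) : C(G ι i, X) := (stage ι i).g

/-- The map `αᵢ : A → Gᵢ(ι)`. -/
def α (ι : C(A, X)) (i : ℕ) : C(A, G ι i) := (stage ι i).α

/-- The map `γᵢ : Gᵢ(ι) → Gᵢ₊₁(ι)`. -/
def γ (ι : C(A, X)) (i : ℕ) : C(G ι i, G ι (i + 1)) :=
  HomotopyPushout.inl (HomotopyPullback.fst (stage ι i).g ι) (HomotopyPullback.snd (stage ι i).g ι)

/-- For `k ≤ n`, the map `γₖ,ₙ = γₙ₋₁ ∘ ⋯ ∘ γₖ : Gₖ(ι) → Gₙ(ι)`, with `γₖ,ₖ = id`. -/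
def γTo (ι : C(A, X)) (k n : ℕ) (h : k ≤ n) : C(G ι k, G ι n) :=
  Nat.leRec (motive := fun n _ => C(G ι k, G ι n)) (ContinuousMap.id (G ι k))
    (fun i _ f => (γ ι i).comp f) h

theorem γTo_self (ι : C(A, X)) (k : ℕ) : γTo ι k k le_rfl = ContinuousMap.id (G ι k) :=
  Nat.leRec_self _ _

theorem γTo_succ (ι : C(A, X)) (k n : ℕ) (h : k ≤ n) :
    γTo ι k (n + 1) (Nat.le_succ_of_le h) = (γ ι n).comp (γTo ι k n h) :=
  Nat.leRec_succ _ _ h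

/-- The relative category of `ι`: the least `n` such that `gₙ` has a homotopy section `s` with
`s ∘ ι ≃ αₙ`; it is `∞` if there is no such `n`. -/
noncomputable def relcat (ι : C(A, X)) : ℕ∞ :=
  sInf ((fun n : ℕ => (n : ℕ∞)) '' {n | ∃ s : C(X, G ι n),
    ((g ι n).comp s).Homotopic (ContinuousMap.id X) ∧ (s.comp ι).Homotopic (α ι n)})

/-- The relative category of order `k` of `ι`: the least `n ≥ k` such that `gₙ` has a homotopy
section `s` with `s ∘ gₖ ≃ γₖ,ₙ`; it is `∞` if there is no such `n`. -/
noncomputable def relcatOrder (k : ℕ) (ι : C(A, X)) : ℕ∞ :=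
  sInf ((fun n : ℕ => (n : ℕ∞)) '' {n | ∃ h : k ≤ n, ∃ s : C(X, G ι n),
    ((g ι n).comp s).Homotopic (ContinuousMap.id X) ∧ (s.comp (g ι k)).Homotopic (γTo ι k n h)})

end Construction

end GaneaConstruction

/-! Left inequality: as `g_k ∘ α_k = ι`, composing `σ ∘ g_k ≃ γ_{k,n}` with `α_k` gives `σ ∘ ι ≃
γ_{k,n} ∘ α_k ≃ α_n`.

Right inequality: since `α_0 = id`, a section realising `relcat ι = n` satisfies the order-0
condition at `n`. It remains to pass from `(k, n)` to `(k + 1, n + 1)`, replacing `σ` by `γ_n ∘ σ`.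
Each Ganea space is the join of the previous one with `ι`, and joins are functorial only for maps
and homotopies over `X`. Hence maps over `X` are modelled by strict lifts to the path fibration
`Fib`, and the induction carries the stronger `HasSectionOver`.

Two results carry the proof. `liftHomotopic_of_homotopic` makes the initial free homotopy one over
`X`. `Join.inl_homotopic_lift` says that, after inclusion into the join of `g` and `ι`, a lift
defined on the join of `f` and `ι` is determined up to homotopy over `X` by its restriction to the
source of `f`. Applied to `σ ∘ g_{k+1}` and to `γ_{k+1,n}`, it reduces their comparison to that of
`σ ∘ g_k` and `γ_{k,n}`. -/

namespace GaneaConstruction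

/-! ### Path fibrations and homotopies of lifts. -/

section Fibration

variable {A B F G X Y Z : Type u} [TopologicalSpace A] [TopologicalSpace B] [TopologicalSpace F]
  [TopologicalSpace G] [TopologicalSpace X] [TopologicalSpace Y] [TopologicalSpace Z]

/-- The path fibration of `g : G → X`: pairs of a point `e` of `G` and a path in `X` starting at
`g e`. Its projection to `X` is `HomotopyPullback.snd`, the evaluation of the path at `1`. -/
abbrev Fib (g : C(G, X)) : Type u := HomotopyPullback g (ContinuousMap.id X)

namespace Fib

/-- The projection of the path fibration onto the base. -/
abbrev proj (g : C(G, X)) : C(Fib g, X) := HomotopyPullback.snd g (ContinuousMap.id X)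

/-- The projection of the path fibration of `g` onto the source of `g`. -/
abbrev point (g : C(G, X)) : C(Fib g, G) := HomotopyPullback.fst g (ContinuousMap.id X)

/-- The path component of a point of the path fibration. -/
def path (g : C(G, X)) : C(Fib g, C(I, X)) where
  toFun y := y.1.2.1
  continuous_toFun := (continuous_fst.comp continuous_snd).comp continuous_subtype_val

theorem path_zero {g : C(G, X)} (y : Fib g) : path g y 0 = g (point g y) := y.2.1

theorem path_one {g : C(G, X)} (y : Fib g) : path g y 1 = proj g y := y.2.2

theorem ext {g : C(G, X)} {y z : Fib g} (h : point g y = point g z)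
    (h' : ∀ v, path g y v = path g z v) : y = z := by
  refine Subtype.ext (Prod.ext h (Prod.ext (ContinuousMap.ext h') ?_))
  exact (path_one y).symm.trans ((h' 1).trans (path_one z))

/-- A continuous family of points of the path fibration. -/
def family {g : C(G, X)} (e : C(Y, G)) (P : C(Y × I, X)) (h : ∀ y, P (y, 0) = g (e y)) :
    C(Y, Fib g) where
  toFun y := ⟨(e y, P.curry y, P (y, 1)), h y, rfl⟩
  continuous_toFun := by
    refine Continuous.subtype_mk ?_ _
    exact e.continuous.prodMk (P.curry.continuous.prodMk (by fun_prop))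

/-- The inclusion of `G` into the path fibration by constant paths. -/
def const (g : C(G, X)) : C(G, Fib g) :=
  family (ContinuousMap.id G) ⟨fun q => g q.1, by fun_prop⟩ fun _ => rfl

/-- The map of path fibrations induced by a map over `X`. -/
def map {f : C(B, X)} {g : C(G, X)} (γ : C(B, G)) (h : ∀ b, g (γ b) = f b) :
    C(Fib f, Fib g) where
  toFun y := ⟨(γ y.1.1, y.1.2.1, y.1.2.2), y.2.1.trans (h _).symm, y.2.2⟩
  continuous_toFun := by
    refine Continuous.subtype_mk ?_ _
    exact (γ.continuous.comp (continuous_fst.comp continuous_subtype_val)).prodMk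
      (continuous_snd.comp continuous_subtype_val)

end Fib

/-- Homotopy of lifts of `w : B → X` to the path fibration of `g`, through such lifts. -/
abbrev LiftHomotopic {g : C(G, X)} (w : C(B, X)) (φ ψ : C(B, Fib g)) : Prop :=
  ContinuousMap.HomotopicWith φ ψ fun χ => ∀ b, Fib.proj g (χ b) = w b

theorem liftHomotopic_of_map {g : C(G, X)} {w : C(B, X)} {φ ψ : C(B, Fib g)}
    (h : C(I × B, Fib g)) (h0 : ∀ b, h (0, b) = φ b) (h1 : ∀ b, h (1, b) = ψ b)
    (hw : ∀ r b, Fib.proj g (h (r, b)) = w b) : LiftHomotopic w φ ψ :=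
  ⟨{ toContinuousMap := h, map_zero_left := h0, map_one_left := h1, prop' := hw }⟩

theorem LiftHomotopic.exists_map {g : C(G, X)} {w : C(B, X)} {φ ψ : C(B, Fib g)}
    (h : LiftHomotopic w φ ψ) : ∃ H : C(I × B, Fib g), (∀ b, H (0, b) = φ b) ∧
      (∀ b, H (1, b) = ψ b) ∧ ∀ r b, Fib.proj g (H (r, b)) = w b :=
  let ⟨H⟩ := h
  ⟨H.toContinuousMap, H.map_zero_left, H.map_one_left, H.prop'⟩

/-! ### Maps and homotopies on double mapping cylinders. -/

namespace HomotopyPushout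

/-- The point of the double mapping cylinder with parameter `t` over a point of `F`. -/
def cyl (β : C(F, B)) (η : C(F, A)) : C(I × F, HomotopyPushout β η) where
  toFun q := Quot.mk _ (.inr (.inl q))
  continuous_toFun := continuous_quot_mk.comp (continuous_inr.comp continuous_inl)

theorem cyl_zero (β : C(F, B)) (η : C(F, A)) (z : F) : cyl β η (0, z) = inl β η (β z) :=
  Quot.sound (.left z)

theorem cyl_one (β : C(F, B)) (η : C(F, A)) (z : F) : cyl β η (1, z) = inr β η (η z) :=
  Quot.sound (.right z)

theorem ind {β : C(F, B)} {η : C(F, A)} {P : HomotopyPushout β η → Prop}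
    (hl : ∀ b, P (inl β η b)) (hc : ∀ t z, P (cyl β η (t, z))) (hr : ∀ a, P (inr β η a))
    (q : HomotopyPushout β η) : P q := by
  induction q using Quot.ind with
  | mk q =>
    rcases q with b | ⟨t, z⟩ | a
    · exact hl b
    · exact hc t z
    · exact hr a

/-- A map out of the double mapping cylinder. -/
def desc {β : C(F, B)} {η : C(F, A)} (u : C(B, Z)) (c : C(I × F, Z)) (v : C(A, Z))
    (h0 : ∀ z, c (0, z) = u (β z)) (h1 : ∀ z, c (1, z) = v (η z)) :
    C(HomotopyPushout β η, Z) where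
  toFun := Quot.lift (Sum.elim u (Sum.elim c v)) (by
    rintro _ _ (z | z)
    · exact h0 z
    · exact h1 z)
  continuous_toFun := continuous_quot_lift _
    (u.continuous.sumElim (c.continuous.sumElim v.continuous))

/-- A homotopy on the double mapping cylinder is given by compatible homotopies on its parts. -/
theorem exists_homotopy {β : C(F, B)} {η : C(F, A)} (u : C(I × B, Z)) (c : C(I × (I × F), Z))
    (v : C(I × A, Z)) (h0 : ∀ r z, c (r, (0, z)) = u (r, β z))
    (h1 : ∀ r z, c (r, (1, z)) = v (r, η z)) :
    ∃ H : C(I × HomotopyPushout β η, Z), (∀ r b, H (r, inl β η b) = u (r, b)) ∧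
      (∀ r t z, H (r, cyl β η (t, z)) = c (r, (t, z))) ∧
      ∀ r a, H (r, inr β η a) = v (r, a) := by
  -- Currying moves the homotopy parameter into the target, so only the quotient itself has to be
  -- mapped out of, not its product with `I`.
  let H : C(HomotopyPushout β η, C(I, Z)) :=
    desc (u.comp ContinuousMap.prodSwap).curry (c.comp ContinuousMap.prodSwap).curry
      (v.comp ContinuousMap.prodSwap).curry (fun z => ContinuousMap.ext fun r => h0 r z)
      (fun z => ContinuousMap.ext fun r => h1 r z)
  exact ⟨H.uncurry.comp ContinuousMap.prodSwap, fun _ _ => rfl, fun _ _ _ => rfl, fun _ _ => rfl⟩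

theorem liftHomotopic {g : C(G, X)} {β : C(F, B)} {η : C(F, A)}
    {w : C(HomotopyPushout β η, X)} {φ ψ : C(HomotopyPushout β η, Fib g)}
    (u : C(I × B, Fib g)) (c : C(I × (I × F), Fib g)) (v : C(I × A, Fib g))
    (h0 : ∀ r z, c (r, (0, z)) = u (r, β z)) (h1 : ∀ r z, c (r, (1, z)) = v (r, η z))
    (u0 : ∀ b, u (0, b) = φ (inl β η b)) (u1 : ∀ b, u (1, b) = ψ (inl β η b))
    (c0 : ∀ t z, c (0, (t, z)) = φ (cyl β η (t, z)))
    (c1 : ∀ t z, c (1, (t, z)) = ψ (cyl β η (t, z)))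
    (v0 : ∀ a, v (0, a) = φ (inr β η a)) (v1 : ∀ a, v (1, a) = ψ (inr β η a))
    (uw : ∀ r b, Fib.proj g (u (r, b)) = w (inl β η b))
    (cw : ∀ r t z, Fib.proj g (c (r, (t, z))) = w (cyl β η (t, z)))
    (vw : ∀ r a, Fib.proj g (v (r, a)) = w (inr β η a)) : LiftHomotopic w φ ψ := by
  obtain ⟨H, hu, hc, hv⟩ := exists_homotopy u c v h0 h1
  refine liftHomotopic_of_map H (fun q => ?_) (fun q => ?_) fun r q => ?_
  · induction q using ind with
    | hl b => rw [hu, u0]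
    | hc t z => rw [hc, c0]
    | hr a => rw [hv, v0]
  · induction q using ind with
    | hl b => rw [hu, u1]
    | hc t z => rw [hc, c1]
    | hr a => rw [hv, v1]
  · induction q using ind with
    | hl b => rw [hu, uw]
    | hc t z => rw [hc, cw]
    | hr a => rw [hv, vw]

end HomotopyPushout

/-! ### Concatenation of paths at a variable time. -/

/-- The curve that runs through `p` on `[c - 1, c]` and agrees with `ω` on `[c, 1]`. -/
noncomputable def splice (p ω : C(I, X)) (c w : ℝ) : X :=
  if w ≤ c then p (Set.projIcc 0 1 zero_le_one (1 + w - c))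
  else ω (Set.projIcc 0 1 zero_le_one w)

theorem continuous_splice {p ω : Y → C(I, X)} {c : Y → I} {w : Y → ℝ} (hp : Continuous p)
    (hω : Continuous ω) (hc : Continuous c) (hw : Continuous w) (h : ∀ y, p y 1 = ω y (c y)) :
    Continuous fun y => splice (p y) (ω y) (c y) (w y) := by
  refine Continuous.if_le ?_ ?_ hw (continuous_subtype_val.comp hc) ?_
  · exact hp.eval (continuous_projIcc.comp (by fun_prop))
  · exact hω.eval (continuous_projIcc.comp hw)
  · intro y hy
    have e1 : Set.projIcc (0 : ℝ) 1 zero_le_one (1 + w y - c y) = 1 := by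
      rw [hy]; exact Set.projIcc_of_right_le _ (by linarith)
    rw [e1, h y, hy, Set.projIcc_val]

theorem splice_of_le (p ω : C(I, X)) {c w : ℝ} (h : w ≤ c) :
    splice p ω c w = p (Set.projIcc 0 1 zero_le_one (1 + w - c)) := if_pos h

theorem splice_of_ge {p ω : C(I, X)} {c : I} {w : I} (h : c ≤ w) (hc : p 1 = ω c) :
    splice p ω c w = ω w := by
  rcases h.eq_or_lt with rfl | h
  · rw [splice_of_le _ _ le_rfl, ← hc, Set.projIcc_of_right_le _ (by linarith)]; rfl
  · rw [splice, if_neg (not_le.2 (show (c : ℝ) < w from h)), Set.projIcc_val]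

end Fibration

end GaneaConstruction

namespace GaneaConstruction

/-! ### Points of the path fibration of a join, from explicit parameters. -/

section Join

variable {A B F G X Y Z : Type u} [TopologicalSpace A] [TopologicalSpace B] [TopologicalSpace F]
  [TopologicalSpace G] [TopologicalSpace X] [TopologicalSpace Y] [TopologicalSpace Z]

/-- The source of the join of `f : B → X` and `ι : A → X`. -/
abbrev Join (f : C(B, X)) (ι : C(A, X)) : Type u :=
  HomotopyPushout (HomotopyPullback.fst f ι) (HomotopyPullback.snd f ι)

/-- The join of `f : B → X` and `ι : A → X`, a map to `X`. -/
abbrev join (f : C(B, X)) (ι : C(A, X)) : C(Join f ι, X) :=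
  HomotopyPushout.whisker _ _ f ι (HomotopyPullback.homotopy f ι)

namespace Join

/-- The canonical map from the source of `f` to the join. -/
abbrev inl (f : C(B, X)) (ι : C(A, X)) : C(B, Join f ι) := HomotopyPushout.inl _ _

/-- The canonical map from the source of `ι` to the join. -/
abbrev inr (f : C(B, X)) (ι : C(A, X)) : C(A, Join f ι) := HomotopyPushout.inr _ _

/-- The cylinder part of the join. -/
abbrev cyl (f : C(B, X)) (ι : C(A, X)) : C(I × HomotopyPullback f ι, Join f ι) :=
  HomotopyPushout.cyl _ _

/-- Points of the path fibration of `g`, prolonged by a path to the image of `ι`, with the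
parameters of `joinPoint`. In `(y, ω, a, c, l, τ, t)` the path of `y` ends at time `c` of the path
`ω`, which ends at `ι a`; the last piece, of length `l`, of the path of `y` starts at the image
of the point underlying `y`. -/
def Data (g : C(G, X)) (ι : C(A, X)) : Type u :=
  {d : Fib g × C(I, X) × A × I × I × I × I //
    Fib.path g d.1 1 = d.2.1 d.2.2.2.1 ∧ d.2.1 1 = ι d.2.2.1 ∧
      Fib.path g d.1 (σ d.2.2.2.2.1) = g (Fib.point g d.1)}

instance (g : C(G, X)) (ι : C(A, X)) : TopologicalSpace (Data g ι) :=
  inferInstanceAs (TopologicalSpace {d : Fib g × C(I, X) × A × I × I × I × I //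
    Fib.path g d.1 1 = d.2.1 d.2.2.2.1 ∧ d.2.1 1 = ι d.2.2.1 ∧
      Fib.path g d.1 (σ d.2.2.2.2.1) = g (Fib.point g d.1)})

namespace Data

variable {g : C(G, X)} {ι : C(A, X)}

/-- The curve of a datum: the path of `y`, followed by the part of `ω` after time `c`. -/
noncomputable def curve (d : Data g ι) (w : ℝ) : X :=
  splice (Fib.path g d.1.1) d.1.2.1 d.1.2.2.2.1 w

/-- The starting time of the curve. -/
def start (d : Data g ι) : ℝ := d.1.2.2.2.1 - d.1.2.2.2.2.1

theorem continuous_val : Continuous fun d : Data g ι => d.1 := continuous_subtype_val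

theorem continuous_start : Continuous (start : Data g ι → ℝ) := by
  have := continuous_val (g := g) (ι := ι)
  unfold start
  fun_prop

theorem continuous_curve {d : Y → Data g ι} {w : Y → ℝ} (hd : Continuous d) (hw : Continuous w) :
    Continuous fun y => (d y).curve (w y) := by
  have hd' := continuous_val.comp hd
  refine continuous_splice ((Fib.path g).continuous.comp hd'.fst) hd'.snd.fst
    hd'.snd.snd.snd.fst hw fun y => (d y).2.1

theorem curve_start (d : Data g ι) : d.curve d.start = g (Fib.point g d.1.1) := by
  rw [← d.2.2.2, curve, start, splice_of_le _ _ (by linarith [d.1.2.2.2.2.1.2.1])]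
  congr 1
  have : 1 + ((d.1.2.2.2.1 : ℝ) - d.1.2.2.2.2.1) - d.1.2.2.2.1 = (σ d.1.2.2.2.2.1 : I) := by
    rw [unitInterval.coe_symm_eq]; ring
  rw [this, Set.projIcc_val]

theorem curve_of_ge (d : Data g ι) {t : I} (h : d.1.2.2.2.1 ≤ t) :
    d.curve t = d.1.2.1 t := splice_of_ge h d.2.1

theorem curve_of_le (d : Data g ι) {w : ℝ} (h : w ≤ d.1.2.2.2.1) :
    d.curve w = Fib.path g d.1.1 (Set.projIcc 0 1 zero_le_one (1 + w - d.1.2.2.2.1)) :=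
  splice_of_le _ _ h

theorem curve_one (d : Data g ι) : d.curve 1 = ι d.1.2.2.1 := by
  rw [← d.2.2.1]
  exact d.curve_of_ge (t := 1) unitInterval.le_one'

/-- The path from the underlying point of `y` to the image of `ι`. -/
noncomputable def pullback : C(Data g ι, HomotopyPullback g ι) where
  toFun d := ⟨(Fib.point g d.1.1, ContinuousMap.curry
      (⟨fun q : Data g ι × I => q.1.curve (q.1.start + q.2 * (1 - q.1.start)), by
        have := continuous_start (g := g) (ι := ι)
        exact continuous_curve continuous_fst (by fun_prop)⟩ : C(Data g ι × I, X)) d, d.1.2.2.1),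
    by simpa using d.curve_start, by simpa using d.curve_one⟩
  continuous_toFun := by
    refine Continuous.subtype_mk ?_ _
    exact ((Fib.point g).continuous.comp continuous_val.fst).prodMk
      ((ContinuousMap.continuous _).prodMk continuous_val.snd.snd.fst)

/-- The point with parameter `τ` of the join over the curve of a datum, together with the path
along the curve to time `t`. -/
noncomputable def joinPoint : C(Data g ι, Fib (join g ι)) :=
  Fib.family ((cyl g ι).comp
      ⟨fun d => (d.1.2.2.2.2.2.1, pullback d),
        continuous_val.snd.snd.snd.snd.snd.fst.prodMk (ContinuousMap.continuous _)⟩)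
    ⟨fun q => q.1.curve ((1 - q.2) * (q.1.start + q.1.1.2.2.2.2.2.1 * (1 - q.1.start))
        + q.2 * q.1.1.2.2.2.2.2.2), by
      have := continuous_start (g := g) (ι := ι)
      have := continuous_val (g := g) (ι := ι)
      exact continuous_curve continuous_fst (by fun_prop)⟩
    fun d => by
      change d.curve _ = d.curve _
      simp

theorem joinPoint_point (d : Data g ι) : Fib.point _ (joinPoint d) =
    cyl g ι (d.1.2.2.2.2.2.1, pullback d) := rfl

theorem joinPoint_path (d : Data g ι) (v : I) : Fib.path _ (joinPoint d) v =
    d.curve ((1 - v) * (d.start + d.1.2.2.2.2.2.1 * (1 - d.start)) + v * d.1.2.2.2.2.2.2) := rfl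

/-- The path ends at time `t` of the curve; since `c ≤ t`, this lies on the part coming from `ω`. -/
theorem proj_joinPoint (d : Data g ι) (h : d.1.2.2.2.1 ≤ d.1.2.2.2.2.2.2) :
    Fib.proj _ (joinPoint d) = d.1.2.1 d.1.2.2.2.2.2.2 := by
  rw [← d.curve_of_ge h, ← Fib.path_one, joinPoint_path]
  simp

end Data

end Join

end Join

end GaneaConstruction

namespace GaneaConstruction

section Join

variable {A B F G X Y Z : Type u} [TopologicalSpace A] [TopologicalSpace B] [TopologicalSpace F]
  [TopologicalSpace G] [TopologicalSpace X] [TopologicalSpace Y] [TopologicalSpace Z]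

namespace HomotopyPullback

/-- The path component of a point of the homotopy pullback. -/
def path (f : C(B, X)) (g : C(A, X)) : C(HomotopyPullback f g, C(I, X)) where
  toFun z := z.1.2.1
  continuous_toFun := (continuous_fst.comp continuous_snd).comp continuous_subtype_val

end HomotopyPullback

namespace Join

namespace Data

variable {g : C(G, X)} {ι : C(A, X)}

/-- A continuous family of data. -/
def family {Y : Type*} [TopologicalSpace Y] (y : C(Y, Fib g)) (ω : C(Y, C(I, X))) (a : C(Y, A))
    (c l τ t : C(Y, I)) (h : ∀ q, Fib.proj g (y q) = ω q (c q)) (h' : ∀ q, ω q 1 = ι (a q))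
    (hl : ∀ q, Fib.path g (y q) (σ (l q)) = g (Fib.point g (y q))) : C(Y, Data g ι) where
  toFun q := ⟨(y q, ω q, a q, c q, l q, τ q, t q),
    ⟨(Fib.path_one (y q)).trans (h q), h' q, hl q⟩⟩
  continuous_toFun := by
    refine Continuous.subtype_mk ?_ _
    fun_prop

/-- At `τ = 0` the cylinder collapses onto the source of `g`, and what is left is the last piece of
the path of `y`, stretched to unit length. The condition `h` says that stretching changes nothing,
as when `l = 1` or the path is constant. -/
theorem joinPoint_zero (d : Data g ι) (hτ : d.1.2.2.2.2.2.1 = 0)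
    (ht : d.1.2.2.2.2.2.2 = d.1.2.2.2.1)
    (h : ∀ v : I, Fib.path g d.1.1 (Set.projIcc 0 1 zero_le_one (1 - (1 - v) * d.1.2.2.2.2.1)) =
      Fib.path g d.1.1 v) :
    joinPoint d = Fib.map (g := join g ι) (inl g ι) (fun _ => rfl) d.1.1 := by
  refine Fib.ext ?_ fun v => ?_
  · rw [joinPoint_point, hτ]
    exact HomotopyPushout.cyl_zero _ _ _
  · rw [joinPoint_path, hτ, ht, curve_of_le]
    · refine Eq.trans ?_ (h v)
      congr 2
      simp only [start, Set.Icc.coe_zero]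
      ring
    · have : 0 ≤ (1 - (v : ℝ)) * d.1.2.2.2.2.1 :=
        mul_nonneg (by linarith [v.2.2]) d.1.2.2.2.2.1.2.1
      simp only [start, Set.Icc.coe_zero]
      linarith

theorem joinPoint_zero' (d : Data g ι) (hτ : d.1.2.2.2.2.2.1 = 0)
    (ht : d.1.2.2.2.2.2.2 = d.1.2.2.2.1) (hl : d.1.2.2.2.2.1 = 1) :
    joinPoint d = Fib.map (g := join g ι) (inl g ι) (fun _ => rfl) d.1.1 :=
  joinPoint_zero d hτ ht fun v => by
    rw [hl]
    congr 1
    simp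

theorem joinPoint_one (d : Data g ι) (hτ : d.1.2.2.2.2.2.1 = 1)
    (ht : d.1.2.2.2.2.2.2 = 1) :
    joinPoint d = Fib.const (join g ι) (inr g ι d.1.2.2.1) := by
  refine Fib.ext ?_ fun v => ?_
  · rw [joinPoint_point, hτ]
    exact HomotopyPushout.cyl_one _ _ _
  · rw [joinPoint_path, hτ, ht]
    refine Eq.trans ?_ d.curve_one
    congr 1
    simp

/-- With `c = 1` the curve up to time 1 is the path of `y` alone, so `ω` plays no role. This is what
allows the end `t = 1` of a cylinder to factor through `A`, where `ω` is forgotten. -/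
theorem joinPoint_congr (d d' : Data g ι) (hy : d.1.1 = d'.1.1) (ha : d.1.2.2.1 = d'.1.2.2.1)
    (hc : d.1.2.2.2.1 = 1) (hc' : d'.1.2.2.2.1 = 1) (hl : d.1.2.2.2.2.1 = d'.1.2.2.2.2.1)
    (hτ : d.1.2.2.2.2.2.1 = d'.1.2.2.2.2.2.1)
    (ht : d.1.2.2.2.2.2.2 = 1) (ht' : d'.1.2.2.2.2.2.2 = 1) :
    joinPoint d = joinPoint d' := by
  have hs : d.start = d'.start := by rw [start, start, hc, hc', hl]
  have hs1 : d.start ≤ 1 := by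
    rw [start, hc]; simpa using d.1.2.2.2.2.1.2.1
  have hcurve : ∀ w : ℝ, w ≤ 1 → d.curve w = d'.curve w := fun w hw => by
    rw [curve_of_le, curve_of_le, hy, hc, hc'] <;> simpa [hc, hc'] using hw
  have hp : pullback d = pullback d' := by
    refine Subtype.ext (Prod.ext ?_ (Prod.ext (ContinuousMap.ext fun u => ?_) ha))
    · exact congrArg (Fib.point g) hy
    · change d.curve _ = d'.curve _
      simp only [← hs]
      exact hcurve _ (by nlinarith [u.2.2])
  refine Fib.ext ?_ fun v => ?_
  · rw [joinPoint_point, joinPoint_point, hτ, hp]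
  · rw [joinPoint_path, joinPoint_path, ← hs, ← hτ, ht, ht']
    apply hcurve
    have h1 := d.1.2.2.2.2.2.1.2.2
    have h2 : d.start + d.1.2.2.2.2.2.1 * (1 - d.start) ≤ 1 := by nlinarith
    have := v.2.1
    have := v.2.2
    simp only [Set.Icc.coe_one]
    nlinarith

end Data

/-! ### Functoriality of the join up to homotopy over `X`. -/

variable {f : C(B, X)} {g : C(G, X)} {ι : C(A, X)}

/-- The functoriality of the join with `ι`, up to homotopy over `X`. -/
noncomputable def lift (φ : C(B, Fib g)) (hφ : ∀ b, Fib.proj g (φ b) = f b) :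
    C(Join f ι, Fib (join g ι)) :=
  HomotopyPushout.desc ((Fib.map (inl g ι) fun _ => rfl).comp φ)
    -- Here `c = 0`, `l = 1` and both `τ` and `t` are the cylinder coordinate: the whole path of `φ
    -- b` is put in front of `ω`.
    (Data.joinPoint.comp (Data.family (φ.comp ((HomotopyPullback.fst f ι).comp .snd))
      ((HomotopyPullback.path f ι).comp .snd) ((HomotopyPullback.snd f ι).comp .snd)
      (.const _ 0) (.const _ 1) .fst .fst
      (fun q => (hφ _).trans q.2.2.1.symm) (fun q => q.2.2.2)
      (fun q => by simpa using Fib.path_zero _)))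
    ((Fib.const _).comp (inr g ι))
    (fun _ => Data.joinPoint_zero' _ rfl rfl rfl)
    (fun _ => Data.joinPoint_one _ rfl rfl)

/-- The construction of `lift` is applied at each time of the homotopy; staying over `f` is what
lets the paths be concatenated with `ω` throughout. -/
theorem lift_homotopic {φ ψ : C(B, Fib g)} (h : LiftHomotopic f φ ψ)
    (hφ : ∀ b, Fib.proj g (φ b) = f b) (hψ : ∀ b, Fib.proj g (ψ b) = f b) :
    LiftHomotopic (join f ι) (lift φ hφ) (lift ψ hψ) := by
  obtain ⟨H, h0, h1, hw⟩ := h.exists_map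
  obtain rfl : H.comp (.prodMk (.const _ 0) (.id _)) = φ := ContinuousMap.ext h0
  obtain rfl : H.comp (.prodMk (.const _ 1) (.id _)) = ψ := ContinuousMap.ext h1
  refine HomotopyPushout.liftHomotopic
    ((Fib.map (inl g ι) fun _ => rfl).comp H)
    (Data.joinPoint.comp (Data.family
      (H.comp (.prodMk .fst ((HomotopyPullback.fst f ι).comp (.comp .snd .snd))))
      ((HomotopyPullback.path f ι).comp (.comp .snd .snd))
      ((HomotopyPullback.snd f ι).comp (.comp .snd .snd))
      (.const _ 0) (.const _ 1) (.comp .fst .snd) (.comp .fst .snd)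
      (fun q => (hw _ _).trans q.2.2.2.1.symm) (fun q => q.2.2.2.2)
      (fun q => by simpa using Fib.path_zero _)))
    ((Fib.const _).comp ((inr g ι).comp .snd))
    (fun r z => Data.joinPoint_zero' _ rfl rfl rfl)
    (fun r z => Data.joinPoint_one _ rfl rfl)
    (fun _ => rfl) (fun _ => rfl) (fun _ _ => rfl) (fun _ _ => rfl) (fun _ => rfl) (fun _ => rfl)
    (fun r b => hw r b) (fun r t z => ?_) (fun _ _ => rfl)
  exact Data.proj_joinPoint _ t.2.1

/-- The lift of the inclusion of `f` as constant paths is homotopic over `X` to the inclusion of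
the join as constant paths. -/
theorem lift_const : LiftHomotopic (join f ι) (lift (Fib.const f) fun _ => rfl)
    (Fib.const (join f ι)) := by
  have hσ : Continuous (σ : I → I) := unitInterval.continuous_symm
  -- The lift puts a constant path of length 1 in front of `ω`; the homotopy shrinks its length `l =
  -- σ r` to 0, leaving `ω` itself.
  let fam : C(I × (I × HomotopyPullback f ι), Data f ι) := Data.family
      ((Fib.const f).comp ((HomotopyPullback.fst f ι).comp (.comp .snd .snd)))
      ((HomotopyPullback.path f ι).comp (.comp .snd .snd))
      ((HomotopyPullback.snd f ι).comp (.comp .snd .snd))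
      (.const _ 0) (.comp ⟨σ, hσ⟩ .fst) (.comp .fst .snd) (.comp .fst .snd)
      (fun q => q.2.2.2.1.symm) (fun q => q.2.2.2.2)
      (fun q => rfl)
  refine HomotopyPushout.liftHomotopic
    ((Fib.map (inl f ι) fun _ => rfl).comp ((Fib.const f).comp .snd))
    (Data.joinPoint.comp fam)
    ((Fib.const _).comp ((inr f ι).comp .snd))
    (fun r z => Data.joinPoint_zero _ rfl rfl fun _ => rfl)
    (fun r z => Data.joinPoint_one _ rfl rfl)
    (fun _ => rfl) (fun _ => rfl) (fun t z => ?_) (fun t z => ?_) (fun _ => rfl) (fun _ => rfl)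
    (fun r b => rfl) (fun r t z => Data.proj_joinPoint _ t.2.1) (fun _ _ => rfl)
  · refine congrArg Data.joinPoint (Subtype.ext ?_)
    change (Fib.const f _, z.1.2.1, z.1.2.2, (0 : I), σ (0 : I), t, t) =
      (Fib.const f _, z.1.2.1, z.1.2.2, (0 : I), (1 : I), t, t)
    rw [unitInterval.symm_zero]
    rfl
  · let d : Data f ι := fam (1, t, z)
    change Data.joinPoint d = _
    have hs : d.start = 0 := by
      change ((0 : I) : ℝ) - (σ (1 : I) : I) = 0
      simp
    have hc : ∀ u : I, d.curve u = z.1.2.1 u := fun u => d.curve_of_ge u.2.1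
    refine Fib.ext ?_ fun v => ?_
    · change cyl f ι (t, Data.pullback d) = cyl f ι (t, z)
      congr 2
      refine Subtype.ext (Prod.ext rfl (Prod.ext (ContinuousMap.ext fun u => ?_) rfl))
      refine Eq.trans ?_ (hc u)
      change d.curve _ = _
      simp [hs]
    · rw [Data.joinPoint_path, hs]
      refine Eq.trans ?_ (hc t)
      congr 1
      change (1 - (v : ℝ)) * (0 + t * (1 - 0)) + v * t = t
      ring

/-- A lift `Ψ` of the join of `f` and `ι` is, after inclusion into the join of `g` and `ι`,
homotopic over `X` to the join of its restriction with the identity of `ι`. -/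
theorem inl_homotopic_lift (Ψ : C(Join f ι, Fib g)) (hΨ : ∀ q, Fib.proj g (Ψ q) = join f ι q) :
    LiftHomotopic (join f ι) ((Fib.map (g := join g ι) (inl g ι) fun _ => rfl).comp Ψ)
      (lift (Ψ.comp (inl f ι)) fun b => hΨ (inl f ι b)) := by
  -- `Ψ` is evaluated at cylinder coordinate `p r * t`, while the join parameter in the target is `s
  -- r * t`. First `s` rises from 0 to 1 with `p = 1`, then `p` falls from 1 to 0 with `s = 1`.
  let p : C(I, I) := ⟨fun r => Set.projIcc 0 1 zero_le_one (2 - 2 * (r : ℝ)),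
    (continuous_projIcc (h := zero_le_one)).comp (by fun_prop)⟩
  let s : C(I, I) := ⟨fun r => Set.projIcc 0 1 zero_le_one (2 * (r : ℝ)),
    (continuous_projIcc (h := zero_le_one)).comp (by fun_prop)⟩
  have p0 : p 0 = 1 := Set.projIcc_of_right_le zero_le_one (by simp)
  have p1 : p 1 = 0 := Set.projIcc_of_le_left zero_le_one (by simp)
  have s0 : s 0 = 0 := Set.projIcc_of_le_left zero_le_one (by simp)
  have s1 : s 1 = 1 := Set.projIcc_of_right_le zero_le_one (by simp)
  -- Needed at the end `t = 1`, where the value may depend only on the point of `A`: if `p r = 1`,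
  -- then `Ψ` is evaluated on `A`; if `s r = 1`, the join parameter is 1 and `Ψ` drops out.
  have ps : ∀ r, p r = 1 ∨ s r = 1 := fun r => by
    rcases le_total (r : ℝ) (1 / 2) with h | h
    · exact .inl (Set.projIcc_of_right_le zero_le_one (by linarith))
    · exact .inr (Set.projIcc_of_right_le zero_le_one (by linarith))
  let fam : C(I × (I × HomotopyPullback f ι), Data g ι) := Data.family
      (Ψ.comp ((cyl f ι).comp (.prodMk (.comp ⟨fun q : I × I => q.1 * q.2, by fun_prop⟩
        (.prodMk (p.comp .fst) (.comp .fst .snd))) (.comp .snd .snd))))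
      ((HomotopyPullback.path f ι).comp (.comp .snd .snd))
      ((HomotopyPullback.snd f ι).comp (.comp .snd .snd))
      ⟨fun q => p q.1 * q.2.1, by fun_prop⟩ (.const _ 1) ⟨fun q => s q.1 * q.2.1, by fun_prop⟩
      (.comp .fst .snd)
      (fun q => hΨ _) (fun q => q.2.2.2.2)
      (fun q => by simpa using Fib.path_zero _)
  -- On `A` no path `ω` is given; the constant path at `ι a` serves, since with `c = 1` the choice
  -- is immaterial.
  let famA : C(I × A, Data g ι) := Data.family
      (Ψ.comp ((inr f ι).comp .snd))
      ((ContinuousMap.curry ⟨fun q : A × I => ι q.1, by fun_prop⟩).comp .snd) .snd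
      (.const _ 1) (.const _ 1) (s.comp .fst) (.const _ 1)
      (fun q => hΨ _) (fun q => rfl)
      (fun q => by simpa using Fib.path_zero _)
  refine HomotopyPushout.liftHomotopic
    ((Fib.map (inl g ι) fun _ => rfl).comp (Ψ.comp ((inl f ι).comp .snd)))
    (Data.joinPoint.comp fam) (Data.joinPoint.comp famA)
    (fun r z => ?_) (fun r z => ?_)
    (fun _ => rfl) (fun _ => rfl) (fun t z => ?_) (fun t z => ?_) (fun a => ?_) (fun a => ?_)
    (fun r b => hΨ _) (fun r t z => ?_) (fun r a => ?_)
  · refine (Data.joinPoint_zero' _ (mul_zero _) (mul_zero _).symm rfl).trans ?_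
    change Fib.map (inl g ι) (fun _ => rfl) (Ψ (cyl f ι (p r * 0, z))) =
      Fib.map (inl g ι) (fun _ => rfl) (Ψ (inl f ι _))
    rw [mul_zero]
    congr 2
    exact HomotopyPushout.cyl_zero _ _ _
  · rcases ps r with h | h
    · refine Data.joinPoint_congr _ _ ?_ rfl ((mul_one _).trans h) rfl rfl (mul_one _) rfl rfl
      change Ψ (cyl f ι (p r * 1, z)) = Ψ (inr f ι _)
      rw [h, mul_one]
      congr 1
      exact HomotopyPushout.cyl_one _ _ _
    · exact (Data.joinPoint_one _ ((mul_one _).trans h) rfl).trans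
        (Data.joinPoint_one (famA (r, z.1.2.2)) h rfl).symm
  · refine (Data.joinPoint_zero' _ ?_ ?_ rfl).trans ?_
    · change s 0 * t = 0
      rw [s0, zero_mul]
    · change t = p 0 * t
      rw [p0, one_mul]
    · change Fib.map (inl g ι) (fun _ => rfl) (Ψ (cyl f ι (p 0 * t, z))) = _
      rw [p0, one_mul]
      rfl
  · refine congrArg Data.joinPoint (Subtype.ext ?_)
    change (Ψ (cyl f ι (p 1 * t, z)), z.1.2.1, z.1.2.2, p 1 * t, (1 : I), s 1 * t, t) =
      (Ψ (inl f ι _), z.1.2.1, z.1.2.2, (0 : I), (1 : I), t, t)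
    rw [p1, s1, zero_mul, one_mul]
    congr 2
    exact HomotopyPushout.cyl_zero _ _ _
  · exact Data.joinPoint_zero' _ s0 rfl rfl
  · exact Data.joinPoint_one _ s1 rfl
  · refine Data.proj_joinPoint _ ?_
    change p r * t ≤ t
    exact mul_le_of_le_one_left t.2.1 (p r).2.2
  · exact Data.proj_joinPoint _ le_rfl

end Join

end Join

end GaneaConstruction

namespace GaneaConstruction

/-! ### From free homotopies to homotopies over the base. -/

section Section

variable {B G X : Type u} [TopologicalSpace B] [TopologicalSpace G] [TopologicalSpace X]

/-- The lift to the path fibration of `g` given by a homotopy section of `g`. -/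
def Fib.ofHomotopySection {g : C(G, X)} {s : C(X, G)}
    (S : ContinuousMap.Homotopy (g.comp s) (ContinuousMap.id X)) : C(X, Fib g) :=
  Fib.family s ⟨fun q => S (q.2, q.1), by fun_prop⟩ fun x => S.apply_zero x

theorem Fib.proj_ofHomotopySection {g : C(G, X)} {s : C(X, G)}
    (S : ContinuousMap.Homotopy (g.comp s) (ContinuousMap.id X)) (x : X) :
    Fib.proj g (Fib.ofHomotopySection S x) = x := S.apply_one x

/-- If `s` is a homotopy section of `g` and `s ∘ f ≃ γ` for a strict lift `γ` of `f`, then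
`s ∘ f` and `γ` are homotopic over `X`: the given homotopy is corrected by the image under `s` of
the loop at `f` formed by its projection and the homotopy of the section. -/
theorem liftHomotopic_of_homotopic {f : C(B, X)} {g : C(G, X)} {γ : C(B, G)}
    (hγ : ∀ b, g (γ b) = f b) {s : C(X, G)}
    (S : ContinuousMap.Homotopy (g.comp s) (ContinuousMap.id X))
    (K : ContinuousMap.Homotopy (s.comp f) γ) :
    LiftHomotopic f ((Fib.ofHomotopySection S).comp f) ((Fib.const g).comp γ) := by
  let cl : ℝ → I := Set.projIcc 0 1 zero_le_one
  have hcl : Continuous cl := continuous_projIcc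
  have cl0 : ∀ w : ℝ, w ≤ 0 → cl w = 0 := fun w hw => Set.projIcc_of_le_left _ hw
  have cl1 : ∀ w : ℝ, 1 ≤ w → cl w = 1 := fun w hw => Set.projIcc_of_right_le _ hw
  have S0 : ∀ x, S (0, x) = g (s x) := fun x => S.apply_zero x
  have S1 : ∀ x, S (1, x) = x := fun x => S.apply_one x
  have K0 : ∀ b, K (0, b) = s (f b) := fun b => K.apply_zero b
  have K1 : ∀ b, K (1, b) = γ b := fun b => K.apply_one b
  have hS := S.continuous
  have hK := K.continuous
  -- The loop at `f b`: on `[-1, 0]` the reverse of `S` from `f b` to `g (s (f b))`, then on `[0,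
  -- 1]` the image of `K`, ending at `g (γ b) = f b`.
  let θ : C(ℝ × B, X) :=
    ⟨fun q => if q.1 ≤ 0 then S (cl (-q.1), f q.2) else g (K (cl q.1, q.2)), by
      refine Continuous.if_le (by fun_prop) (by fun_prop) (by fun_prop) (by fun_prop) ?_
      rintro ⟨w, b⟩ h
      change w = 0 at h
      simp only [h, neg_zero, cl0 0 le_rfl, S0, K0]⟩
  have θle : ∀ w b, w ≤ 0 → θ (w, b) = S (cl (-w), f b) := fun w b h => if_pos h
  have θge : ∀ w b, 0 < w → θ (w, b) = g (K (cl w, b)) := fun w b h => if_neg (not_le.2 h)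
  -- On `[c - 1, c]` the path `S` from `g (s (θ c))` to `θ c`, then the rest of `θ` up to time 1.
  let κ : C(ℝ × ℝ × B, X) :=
    ⟨fun q => if q.2.1 ≤ q.1 then S (cl (1 + q.2.1 - q.1), θ (q.1, q.2.2)) else θ q.2, by
      refine Continuous.if_le (by fun_prop) (by fun_prop) (by fun_prop) (by fun_prop) ?_
      rintro ⟨c, w, b⟩ h
      change w = c at h
      have : 1 + c - c = 1 := by ring
      simp only [h, this, cl1 1 le_rfl, S1]⟩
  have κle : ∀ c w b, w ≤ c → κ (c, w, b) = S (cl (1 + w - c), θ (c, b)) := fun c w b h => if_pos h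
  have κge : ∀ c w b, c < w → κ (c, w, b) = θ (w, b) := fun c w b h => if_neg (not_le.2 h)
  have θ1 : ∀ b, θ (1, b) = f b := fun b => by rw [θge _ _ one_pos, cl1 1 le_rfl, K1, hγ]
  have θ1' : ∀ b, θ (-1, b) = f b := fun b => by
    rw [θle _ _ (by norm_num), cl1 _ (by norm_num), S1]
  have κ1 : ∀ c b, c ≤ 1 → κ (c, 1, b) = f b := fun c b h => by
    rcases h.eq_or_lt with rfl | h
    · rw [κle _ _ _ le_rfl, cl1 _ (by norm_num), S1, θ1]
    · rw [κge _ _ _ h, θ1]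
  -- On `[-2, 0]` the path `S` is followed up to height `c` and back; letting `c` fall to 0 cancels
  -- it.
  let ρ : C(ℝ × ℝ × B, X) :=
    ⟨fun q => if q.2.1 ≤ 0 then S (cl (q.1 * (1 - |q.2.1 + 1|)), f q.2.2)
        else g (K (cl q.2.1, q.2.2)), by
      refine Continuous.if_le (by fun_prop) (by fun_prop) (by fun_prop) (by fun_prop) ?_
      rintro ⟨c, w, b⟩ h
      change w = 0 at h
      simp [h, cl0 0 le_rfl, S0, K0]⟩
  have ρle : ∀ c w b, w ≤ 0 → ρ (c, w, b) = S (cl (c * (1 - |w + 1|)), f b) :=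
    fun c w b h => if_pos h
  have ρge : ∀ c w b, 0 < w → ρ (c, w, b) = g (K (cl w, b)) := fun c w b h => if_neg (not_le.2 h)
  -- Three stages: `H₁` drags the point `s (θ c)` backwards round the loop, from `c = 1` to `c =
  -- -1`; `H₂` cancels `S` against its reverse; `H₃` moves the point along `K` while shortening the
  -- path to a constant. The endpoint in `X` is `f b` throughout.
  let H₁ : C(I × B, Fib g) := Fib.family ⟨fun q => s (θ (1 - 2 * q.1, q.2)), by fun_prop⟩
    ⟨fun q => κ (1 - 2 * q.1.1, -2 * q.1.1 + q.2 * (1 + 2 * q.1.1), q.1.2), by fun_prop⟩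
    fun q => by
      change κ (_, -2 * (q.1 : ℝ) + (0 : I) * (1 + 2 * q.1), _) = g (s _)
      rw [κle _ _ _ (by simp), cl0 _ (by simp), S0]
  let H₂ : C(I × B, Fib g) := Fib.family ⟨fun q => s (f q.2), by fun_prop⟩
    ⟨fun q => ρ (1 - q.1.1, -2 + 3 * q.2, q.1.2), by fun_prop⟩
    fun q => by
      change ρ (_, -2 + 3 * ((0 : I) : ℝ), _) = g (s _)
      rw [ρle _ _ _ (by simp), cl0 _ (by norm_num), S0]
  let H₃ : C(I × B, Fib g) := Fib.family ⟨fun q => K (cl (-2 + 3 * q.1), q.2), by fun_prop⟩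
    ⟨fun q => g (K (cl (-2 + 3 * q.1.1 + q.2 * (3 - 3 * q.1.1)), q.1.2)), by fun_prop⟩
    fun q => by simp
  have h₁ : LiftHomotopic f ((Fib.ofHomotopySection S).comp f)
      (H₁.comp (.prodMk (.const _ 1) (.id _))) := by
    refine liftHomotopic_of_map H₁ (fun b => ?_) (fun b => rfl) fun r b => ?_
    · refine Fib.ext ?_ fun v => ?_
      · change s (θ (1 - 2 * ((0 : I) : ℝ), b)) = s (f b)
        simp [θ1]
      · change κ (1 - 2 * ((0 : I) : ℝ), -2 * ((0 : I) : ℝ) + v * (1 + 2 * ((0 : I) : ℝ)), b) =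
          S (v, f b)
        rw [κle _ _ _ (by simpa using v.2.2)]
        simp [θ1, cl]
    · change κ (1 - 2 * r, -2 * r + ((1 : I) : ℝ) * (1 + 2 * r), b) = f b
      have : -2 * (r : ℝ) + ((1 : I) : ℝ) * (1 + 2 * r) = 1 := by simp
      rw [this, κ1 _ _ (by simpa using r.2.1)]
  have h₂ : LiftHomotopic f (H₁.comp (.prodMk (.const _ 1) (.id _)))
      (H₂.comp (.prodMk (.const _ 1) (.id _))) := by
    refine liftHomotopic_of_map H₂ (fun b => ?_) (fun b => rfl) fun r b => ?_
    · refine Fib.ext ?_ fun v => ?_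
      · change s (f b) = s (θ (1 - 2 * ((1 : I) : ℝ), b))
        have : 1 - 2 * ((1 : I) : ℝ) = -1 := by norm_num
        rw [this, θ1']
      · change ρ (1 - ((0 : I) : ℝ), -2 + 3 * v, b) =
          κ (1 - 2 * ((1 : I) : ℝ), -2 * ((1 : I) : ℝ) + v * (1 + 2 * ((1 : I) : ℝ)), b)
        have e1 : 1 - 2 * ((1 : I) : ℝ) = -1 := by norm_num
        have e2 : -2 * ((1 : I) : ℝ) + v * (1 + 2 * ((1 : I) : ℝ)) = -2 + 3 * v := by
          norm_num; ring
        have e3 : 1 - ((0 : I) : ℝ) = 1 := by simp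
        rw [e1, e2, e3]
        generalize -2 + 3 * (v : ℝ) = w
        rcases le_or_gt w (-1) with hw | hw
        · rw [ρle _ _ _ (by linarith), κle _ _ _ hw, θ1', abs_of_nonpos (by linarith)]
          congr 3; ring
        · rw [κge _ _ _ hw]
          rcases le_or_gt w 0 with hw' | hw'
          · rw [ρle _ _ _ hw', θle _ _ hw', abs_of_pos (by linarith)]
            congr 3; ring
          · rw [ρge _ _ _ hw', θge _ _ hw']
    · change ρ (_, -2 + 3 * ((1 : I) : ℝ), b) = f b
      rw [ρge _ _ _ (by norm_num), cl1 _ (by norm_num), K1, hγ]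
  refine (h₁.trans h₂).trans (liftHomotopic_of_map H₃ (fun b => ?_) (fun b => ?_) fun r b => ?_)
  · refine Fib.ext ?_ fun v => ?_
    · change K (cl (-2 + 3 * ((0 : I) : ℝ)), b) = s (f b)
      rw [cl0 _ (by norm_num), K0]
    · change g (K (cl (-2 + 3 * ((0 : I) : ℝ) + v * (3 - 3 * ((0 : I) : ℝ))), b)) =
        ρ (1 - ((1 : I) : ℝ), -2 + 3 * v, b)
      have e1 : -2 + 3 * ((0 : I) : ℝ) + v * (3 - 3 * ((0 : I) : ℝ)) = -2 + 3 * v := by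
        norm_num; ring
      have e2 : 1 - ((1 : I) : ℝ) = 0 := by simp
      rw [e1, e2]
      rcases le_or_gt (-2 + 3 * (v : ℝ)) 0 with hw | hw
      · rw [ρle _ _ _ hw, cl0 _ hw, zero_mul, cl0 _ le_rfl, S0, K0]
      · rw [ρge _ _ _ hw]
  · refine Fib.ext ?_ fun v => ?_
    · change K (cl (-2 + 3 * ((1 : I) : ℝ)), b) = γ b
      rw [cl1 _ (by norm_num), K1]
    · change g (K (cl (-2 + 3 * ((1 : I) : ℝ) + v * (3 - 3 * ((1 : I) : ℝ))), b)) = g (γ b)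
      rw [cl1 _ (by norm_num), K1]
  · change g (K (cl (-2 + 3 * (r : ℝ) + ((1 : I) : ℝ) * (3 - 3 * r)), b)) = f b
    rw [cl1 _ (by norm_num), K1, hγ]

end Section

/-! ### The Ganea construction and the two inequalities. -/

section Ganea

variable {A X : Type u} [TopologicalSpace A] [TopologicalSpace X] (ι : C(A, X))

theorem g_γTo {k n : ℕ} (h : k ≤ n) (x : G ι k) : g ι n (γTo ι k n h x) = g ι k x := by
  induction n, h using Nat.le_induction with
  | base => rw [γTo_self]; rfl
  | succ n h ih =>
    rw [γTo_succ]
    exact ih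

theorem γTo_comp_γ {k n : ℕ} (h : k + 1 ≤ n) :
    (γTo ι (k + 1) n h).comp (γ ι k) = γTo ι k n (Nat.le_of_succ_le h) := by
  induction n, h using Nat.le_induction with
  | base => rw [γTo_self, γTo_succ ι k k le_rfl, γTo_self]; rfl
  | succ n h ih =>
    rw [γTo_succ ι _ _ h, γTo_succ ι k n (Nat.le_of_succ_le h), ← ih]
    rfl

theorem g_α (n : ℕ) (a : A) : g ι n (α ι n a) = ι a := by
  cases n <;> rfl

/-- As `g_n ∘ α_n = ι`, the constant path at `ι a` is a point of the homotopy pullback, and the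
cylinder segment over it joins the two images of `a`. -/
theorem γ_comp_α_homotopic (n : ℕ) : ((γ ι n).comp (α ι n)).Homotopic (α ι (n + 1)) := by
  let z : C(A, HomotopyPullback (stage ι n).g ι) :=
    ⟨fun a => ⟨(α ι n a, (ContinuousMap.const I (ι a)), a), (g_α ι n a).symm, rfl⟩, by
      refine Continuous.subtype_mk ?_ _
      exact (α ι n).continuous.prodMk
        ((ContinuousMap.continuous_const'.comp ι.continuous).prodMk continuous_id)⟩
  exact ⟨{
    toContinuousMap := (Join.cyl (stage ι n).g ι).comp (.prodMap (.id I) z)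
    map_zero_left := fun a => HomotopyPushout.cyl_zero _ _ (z a)
    map_one_left := fun a => HomotopyPushout.cyl_one _ _ (z a) }⟩

theorem γTo_comp_α_homotopic {k n : ℕ} (h : k ≤ n) :
    ((γTo ι k n h).comp (α ι k)).Homotopic (α ι n) := by
  induction n, h using Nat.le_induction with
  | base => rw [γTo_self]; exact .refl _
  | succ n h ih =>
    rw [γTo_succ ι k n h]
    exact ((ContinuousMap.Homotopic.refl (γ ι n)).comp ih).trans (γ_comp_α_homotopic ι n)

/-- A section `s` of the path fibration of `gₙ` such that `s ∘ gₖ` and `γₖ,ₙ` are homotopic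
over `X`. -/
def HasSectionOver {k n : ℕ} (h : k ≤ n) : Prop :=
  ∃ s : C(X, Fib (g ι n)), (∀ x, Fib.proj _ (s x) = x) ∧
    LiftHomotopic (g ι k) (s.comp (g ι k)) ((Fib.const (g ι n)).comp (γTo ι k n h))

variable {ι}

/-- Both maps to be compared are homotopic over `X` to joins with `ι`, of `s ∘ g_k` and of `γ_{k,n}`
respectively, and these joins are homotopic by hypothesis. -/
theorem HasSectionOver.succ {k n : ℕ} {h : k ≤ n} (H : HasSectionOver ι h) :
    HasSectionOver ι (Nat.succ_le_succ h) := by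
  obtain ⟨s, hs, hH⟩ := H
  refine ⟨(Fib.map (g := g ι (n + 1)) (γ ι n) fun _ => rfl).comp s, hs, ?_⟩
  have h₁ := Join.inl_homotopic_lift (f := g ι k) (g := g ι n) (ι := ι)
    (s.comp (g ι (k + 1))) fun q => hs _
  have h₂ := Join.lift_homotopic (ι := ι) hH (fun b => hs _) (fun b => g_γTo ι h b)
  refine (h₁.trans h₂).trans ?_
  -- For `k < n`, `γ_{k,n}` is the restriction of `γ_{k+1,n}`, so `Join.inl_homotopic_lift` applies
  -- again. For `k = n` no such extension is available, and the join of the identity is identified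
  -- by `Join.lift_const`.
  rcases h.eq_or_lt with rfl | h'
  · have h₃ := Join.lift_const (f := g ι k) (ι := ι)
    simp only [γTo_self]
    exact h₃
  · have h₃ := Join.inl_homotopic_lift (f := g ι k) (g := g ι n) (ι := ι)
      ((Fib.const (g ι n)).comp (γTo ι (k + 1) n h')) fun q => g_γTo ι h' q
    rw [γTo_succ ι (k + 1) n h']
    simp only [← γTo_comp_γ ι h']
    exact h₃.symm

theorem HasSectionOver.add {n : ℕ} (H : HasSectionOver ι (Nat.zero_le n)) (k : ℕ) :
    HasSectionOver ι (Nat.le_add_left k n) := by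
  induction k with
  | zero => exact H
  | succ k ih => exact ih.succ

theorem hasSectionOver_zero {n : ℕ} {s : C(X, G ι n)}
    (hs : ((g ι n).comp s).Homotopic (ContinuousMap.id X))
    (hα : (s.comp ι).Homotopic (α ι n)) : HasSectionOver ι (Nat.zero_le n) := by
  obtain ⟨S⟩ := hs
  -- Since `g_0 = ι` and `α_0 = id`, the condition on `α_n` becomes one on `γ_{0,n}`.
  obtain ⟨K⟩ : (s.comp (g ι 0)).Homotopic (γTo ι 0 n (Nat.zero_le n)) :=
    hα.trans (γTo_comp_α_homotopic ι (Nat.zero_le n)).symm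
  exact ⟨Fib.ofHomotopySection S, Fib.proj_ofHomotopySection S,
    liftHomotopic_of_homotopic (g_γTo ι (Nat.zero_le n)) S K⟩

theorem HasSectionOver.exists_homotopySection {k n : ℕ} {h : k ≤ n} (H : HasSectionOver ι h) :
    ∃ s : C(X, G ι n), ((g ι n).comp s).Homotopic (ContinuousMap.id X) ∧
      (s.comp (g ι k)).Homotopic (γTo ι k n h) := by
  obtain ⟨s, hs, ⟨K⟩⟩ := H
  refine ⟨(Fib.point _).comp s, ?_,
    (ContinuousMap.Homotopic.refl (Fib.point _)).comp ⟨K.toHomotopy⟩⟩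
  have h₁ : ((g ι n).comp ((Fib.point _).comp s)).Homotopic
      (((ContinuousMap.id X).comp (Fib.proj _)).comp s) :=
    .comp ⟨HomotopyPullback.homotopy (g ι n) (ContinuousMap.id X)⟩ (.refl s)
  rwa [show ((ContinuousMap.id X).comp (Fib.proj _)).comp s = .id X from
    ContinuousMap.ext hs] at h₁

theorem relcat_le_relcatOrder (ι : C(A, X)) (k : ℕ) : relcat ι ≤ relcatOrder k ι := by
  refine le_sInf ?_
  rintro _ ⟨n, ⟨h, s, hs, hk⟩, rfl⟩
  refine sInf_le ⟨n, ⟨s, hs, ?_⟩, rfl⟩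
  have h₁ := (hk.comp (.refl (α ι k))).trans (γTo_comp_α_homotopic ι h)
  rwa [show (s.comp (g ι k)).comp (α ι k) = s.comp ι from
    ContinuousMap.ext fun a => congrArg s (g_α ι k a)] at h₁

theorem relcatOrder_le_relcat_add (ι : C(A, X)) (k : ℕ) : relcatOrder k ι ≤ relcat ι + k := by
  rcases ((fun n : ℕ => (n : ℕ∞)) '' {n | ∃ s : C(X, G ι n),
    ((g ι n).comp s).Homotopic (ContinuousMap.id X) ∧
      (s.comp ι).Homotopic (α ι n)}).eq_empty_or_nonempty with he | hne
  · rw [relcat, he, sInf_empty, top_add]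
    exact le_top
  -- A nonempty set in `ℕ∞` attains its infimum, so `relcat ι` is realised by an actual section.
  · obtain ⟨n, ⟨s, hs, hα⟩, hn⟩ := csInf_mem hne
    refine sInf_le ⟨n + k, ⟨Nat.le_add_left k n, ?_⟩, ?_⟩
    · exact ((hasSectionOver_zero hs hα).add k).exists_homotopySection
    · rw [relcat, ← hn]
      exact Nat.cast_add n k

end Ganea

end GaneaConstruction

theorem mainTheorem6 {A X : Type u} [TopologicalSpace A] [TopologicalSpace X] (ι : C(A, X))
    (k : ℕ) :
    GaneaConstruction.relcat ι ≤ GaneaConstruction.relcatOrder k ι ∧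
      GaneaConstruction.relcatOrder k ι ≤ GaneaConstruction.relcat ι + k :=
  ⟨GaneaConstruction.relcat_le_relcatOrder ι k, GaneaConstruction.relcatOrder_le_relcat_add ι k⟩
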